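/- Let $p$ be a prime and let $s\in\mathbf C$ with $0<|s|<1$ and $m\in\{0,1,2,\dots\}\cup\{\infty\}$. Write each $x\in\mathbf Q_p$ uniquely as $x=\sum_{n\in\mathbf Z}x_np^n$ with $x_n\in\{0,\dots,p-1\}$ and $x_n=0$ for all sufficiently negative $n$, let $v(x)$ be the $p$-adic valuation of $x$, and put $$\chi_n^{(m)}(x)=\exp\Bigl(\frac{2\pi i}{p}\sum_{k=0}^{m}x_{n-k}p^{-k}\Bigr),\qquad \Upsilon_s^{(m)}(x)=\frac{1-s^{v(x)}}{1-s}+\sum_{n=v(x)}^{\infty}s^n\chi_n^{(m)}(x),$$ with $\Upsilon_s^{(m)}(0)=\frac1{1-s}$. Let $$\Delta_s^{(m)}=\inf\{|\Upsilon_s^{(m)}(x)-\Upsilon_s^{(m)}(y)| : x,y\in\mathbf Q_p,\ |x-y|_p=1\},\qquad D_s=-\frac{1}{\log_p|s|},$$ let $h^{D_s}$ be the $D_s$-dimensional Hausdorff (outer) measure on $\mathbf C$, and let $\chi$ be the Haar measure on $\mathbf Q_p$ with $\chi(\mathbf Z_p)=1$. Suppose $\Delta_s^{(m)}>0$. Then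 $0<h^{D_s}(\Upsilon_s^{(m)}(\mathbf Z_p))<\infty$, and the normalized measure $$\mu_f(B)=\frac{h^{D_s}\bigl(B\cap\Upsilon_s^{(m)}(\mathbf Q_p)\bigr)}{h^{D_s}\bigl(\Upsilon_s^{(m)}(\mathbf Z_p)\bigr)}\qquad(B\subset\mathbf C)$$ satisfies $$\mu_f(B)=\chi\bigl((\Upsilon_s^{(m)})^{-1}(B)\bigr)\qquad\text{for all } B\subset\mathbf C,$$ where both sides are read as outer measures if $B$ is not Borel. -/

import Mathlib

open MeasureTheory

namespace PadicFractal

noncomputable section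

/-- A sequence `a` of base-`p` digits (indexed by `ℤ`, vanishing far to the left) with
`x = ∑ a n * p ^ n` in `ℚ_[p]`. -/
def IsExpansion (p : ℕ) [Fact p.Prime] (x : ℚ_[p]) (a : ℤ → ℕ) : Prop :=
  (∀ n, a n < p) ∧ (∃ v : ℤ, ∀ n < v, a n = 0) ∧
    HasSum (fun n : ℤ => (a n : ℚ_[p]) * (p : ℚ_[p]) ^ n) x

theorem exists_isExpansion_int (p : ℕ) [hp : Fact p.Prime] (z : ℤ_[p]) :
    ∃ b : ℕ → ℕ, (∀ n, b n < p) ∧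
      HasSum (fun n : ℕ => (b n : ℚ_[p]) * (p : ℚ_[p]) ^ n) (z : ℚ_[p]) := by
  have hpos : ∀ n : ℕ, 0 < p ^ n := fun n => pow_pos hp.out.pos n
  have key : ∀ n, z.appr (n + 1) = z.appr n + p ^ n * (z.appr (n + 1) / p ^ n) := by
    intro n
    have h1 : z.appr (n + 1) % p ^ n = z.appr n := by
      have h := (Nat.modEq_iff_dvd' (z.appr_mono (Nat.le_succ n))).2
        (z.dvd_appr_sub_appr n (n + 1) (Nat.le_succ n))
      rw [← h, Nat.mod_eq_of_lt (z.appr_lt n)]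
    have h2 := Nat.mod_add_div (z.appr (n + 1)) (p ^ n)
    omega
  refine ⟨fun n => z.appr (n + 1) / p ^ n, fun n => ?_, ?_⟩
  · rw [Nat.div_lt_iff_lt_mul (hpos n), mul_comm, ← pow_succ]
    exact z.appr_lt (n + 1)
  · have hsum : Summable
        (fun n : ℕ => ((z.appr (n + 1) / p ^ n : ℕ) : ℚ_[p]) * (p : ℚ_[p]) ^ n) := by
      refine Summable.of_norm_bounded (g := fun n : ℕ => ((p : ℝ)⁻¹) ^ n) ?_ fun n => ?_
      · exact summable_geometric_of_lt_one (by positivity)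
          (inv_lt_one_of_one_lt₀ (mod_cast hp.out.one_lt))
      · rw [norm_mul, norm_pow, Padic.norm_p]
        exact mul_le_of_le_one_left (by positivity) (by
          rw [← Int.cast_natCast]
          exact Padic.norm_int_le_one _)
    have hpart : ∀ N : ℕ, ∑ n ∈ Finset.range N,
        ((z.appr (n + 1) / p ^ n : ℕ) : ℚ_[p]) * (p : ℚ_[p]) ^ n = (z.appr N : ℚ_[p]) := by
      intro N
      induction N with
      | zero => simp [PadicInt.appr]
      | succ N ih =>
        rw [Finset.sum_range_succ, ih]
        conv_rhs => rw [key N]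
        push_cast
        ring
    have hlim : Filter.Tendsto (fun N : ℕ => (z.appr N : ℚ_[p])) Filter.atTop
        (nhds (z : ℚ_[p])) := by
      rw [tendsto_iff_norm_sub_tendsto_zero]
      refine squeeze_zero (g := fun N : ℕ => ((p : ℝ)⁻¹) ^ N) (fun _ => norm_nonneg _)
        (fun N => ?_) (tendsto_pow_atTop_nhds_zero_of_lt_one (by positivity)
          (inv_lt_one_of_one_lt₀ (mod_cast hp.out.one_lt)))
      have h := (PadicInt.norm_le_pow_iff_mem_span_pow _ N).2 (z.appr_spec N)
      rw [PadicInt.norm_def] at h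
      push_cast at h
      rw [norm_sub_rev]
      simpa using h
    have h3 := hsum.hasSum.tendsto_sum_nat
    simp only [hpart] at h3
    rw [← tendsto_nhds_unique h3 hlim]
    exact hsum.hasSum

theorem exists_isExpansion (p : ℕ) [hp : Fact p.Prime] (x : ℚ_[p]) :
    ∃ a : ℤ → ℕ, IsExpansion p x a := by
  have hp0 : (p : ℚ_[p]) ≠ 0 := mod_cast hp.out.ne_zero
  obtain ⟨K, hK⟩ : ∃ K : ℕ, ‖(p : ℚ_[p]) ^ K * x‖ ≤ 1 := by
    obtain ⟨K, hK⟩ := pow_unbounded_of_one_lt ‖x‖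
      (show (1 : ℝ) < p from mod_cast hp.out.one_lt)
    refine ⟨K, ?_⟩
    rw [norm_mul, norm_pow, Padic.norm_p, inv_pow, inv_mul_le_iff₀ (by
      have := hp.out.pos
      positivity)]
    linarith
  obtain ⟨b, hb, hs⟩ := exists_isExpansion_int p ⟨_, hK⟩
  refine ⟨fun n => if 0 ≤ n + K then b (n + K).toNat else 0, fun n => ?_, ⟨-K, fun n hn => ?_⟩, ?_⟩
  · dsimp only
    split_ifs
    · exact hb _
    · exact hp.out.pos
  · exact if_neg (by omega)
  · have hinj : Function.Injective (fun j : ℕ => (j : ℤ) - K) := by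
      intro i j h
      simpa using h
    rw [← hinj.hasSum_iff]
    · have h := hs.mul_left (((p : ℚ_[p]) ^ K)⁻¹)
      have hx : ((p : ℚ_[p]) ^ K)⁻¹ * ((p : ℚ_[p]) ^ K * x) = x :=
        inv_mul_cancel_left₀ (pow_ne_zero _ hp0) x
      rw [hx] at h
      have e : ∀ j : ℕ, ((p : ℚ_[p]) ^ K)⁻¹ * ((b j : ℚ_[p]) * (p : ℚ_[p]) ^ j) =
          ((fun n : ℤ => (((if 0 ≤ n + K then b (n + K).toNat else 0 : ℕ) : ℚ_[p]) *
            (p : ℚ_[p]) ^ n)) ∘ fun j : ℕ => (j : ℤ) - K) j := by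
        intro j
        simp only [Function.comp_apply, sub_add_cancel, Int.natCast_nonneg, if_true,
          Int.toNat_natCast]
        rw [zpow_sub₀ hp0, zpow_natCast, zpow_natCast]
        field_simp
      exact (funext e) ▸ h
    · intro n hn
      have : ¬ 0 ≤ n + K := fun h => hn ⟨(n + K).toNat, by dsimp only; omega⟩
      simp [this]

theorem IsExpansion.unique {p : ℕ} [hp : Fact p.Prime] {x : ℚ_[p]} {a b : ℤ → ℕ}
    (ha : IsExpansion p x a) (hb : IsExpansion p x b) : a = b := by
  obtain ⟨ha1, ⟨v, hv⟩, ha2⟩ := ha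
  obtain ⟨hb1, ⟨w, hw⟩, hb2⟩ := hb
  by_contra hne
  obtain ⟨n1, hn1⟩ := Function.ne_iff.1 hne
  obtain ⟨n, hn, hmin⟩ := Int.exists_least_of_bdd (P := fun n => a n ≠ b n)
    ⟨min v w, fun z hz => by
      by_contra h
      rw [not_le, lt_min_iff] at h
      exact hz (by rw [hv z h.1, hw z h.2])⟩ ⟨n1, hn1⟩
  have hp1 : (1 : ℝ) < p := mod_cast hp.out.one_lt
  have hd := ha2.sub hb2
  rw [sub_self] at hd
  set c : ℤ → ℚ_[p] := fun k => a k * (p : ℚ_[p]) ^ k - b k * (p : ℚ_[p]) ^ k with hc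
  have hcn : ∀ k, c k = (((a k : ℤ) - (b k : ℤ) : ℤ) : ℚ_[p]) * (p : ℚ_[p]) ^ k := by
    intro k
    simp only [hc]
    push_cast
    ring
  have hnorm : ‖c n‖ = (p : ℝ) ^ (-n) := by
    rw [hcn, norm_mul, Padic.norm_p_zpow]
    have h1 : ‖(((a n : ℤ) - (b n : ℤ) : ℤ) : ℚ_[p])‖ = 1 := by
      refine le_antisymm (Padic.norm_int_le_one _) (not_lt.1 fun h => ?_)
      rw [Padic.norm_intCast_lt_one_iff] at h
      have h2 := Int.eq_zero_of_abs_lt_dvd h (by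
        have := ha1 n
        have := hb1 n
        rw [abs_lt]
        omega)
      exact hn (by omega)
    rw [h1, one_mul]
  have hle : ∀ k, k ≠ n → ‖c k‖ ≤ (p : ℝ) ^ (-(n + 1)) := by
    intro k hk
    rcases lt_or_gt_of_ne hk with h | h
    · have : a k = b k := by
        by_contra h'
        exact absurd (hmin k h') (by omega)
      rw [hcn, this]
      simp
      positivity
    · rw [hcn, norm_mul, Padic.norm_p_zpow]
      calc _ ≤ 1 * (p : ℝ) ^ (-k) := by
            gcongr
            exact Padic.norm_int_le_one _
        _ ≤ _ := by
            rw [one_mul]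
            exact zpow_le_zpow_right₀ hp1.le (by omega)
  have hupd := hd.update n 0
  have hlast : ‖(0 : ℚ_[p]) - c n + 0‖ ≤ (p : ℝ) ^ (-(n + 1)) := by
    refine (Metric.isClosed_closedBall (x := (0 : ℚ_[p])) (ε := (p : ℝ) ^ (-(n + 1)))).mem_of_tendsto
      hupd (Filter.Eventually.of_forall fun t => ?_) |> mem_closedBall_zero_iff.1
    rw [mem_closedBall_zero_iff]
    refine IsUltrametricDist.norm_sum_le_of_forall_le_of_nonneg (by positivity) fun k _ => ?_
    by_cases hk : k = n
    · subst hk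
      simp
      positivity
    · rw [Function.update_of_ne hk]
      exact hle k hk
  rw [add_zero, zero_sub, norm_neg, hnorm] at hlast
  have := zpow_lt_zpow_right₀ hp1 (show -(n + 1) < -n by omega)
  linarith

/-- The `n`-th digit `xₙ` in the expansion `x = ∑ xₙ pⁿ`, `xₙ ∈ {0, …, p - 1}`. -/
def digit (p : ℕ) [Fact p.Prime] (x : ℚ_[p]) : ℤ → ℕ :=
  (exists_isExpansion p x).choose

theorem isExpansion_digit (p : ℕ) [Fact p.Prime] (x : ℚ_[p]) : IsExpansion p x (digit p x) :=
  (exists_isExpansion p x).choose_spec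

/-- `χₙ⁽ᵐ⁾(x) = exp ((2πi / p) ∑_{k=0}^m x_{n-k} p^{-k})`, for `m ∈ ℕ ∪ {∞}`. Only finitely many
terms of the inner sum are nonzero, also for `m = ∞`. -/
def chi (p : ℕ) [Fact p.Prime] (m : ℕ∞) (n : ℤ) (x : ℚ_[p]) : ℂ :=
  Complex.exp (2 * Real.pi * Complex.I / p *
    ∑' k : ℕ, if (k : ℕ∞) ≤ m then (digit p x (n - k) : ℂ) / (p : ℂ) ^ k else 0)

/-- `Υₛ⁽ᵐ⁾(x) = (1 - s^v) / (1 - s) + ∑_{n ≥ v} sⁿ χₙ⁽ᵐ⁾(x)` with `v = v(x)`, for `0 < |s| < 1`.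
At `x = 0`, where `v(x) = ∞`, the value of the formula is `1 / (1 - s)`. Mathlib's convention
`(0 : ℚ_[p]).valuation = 0` gives the same value, since all `χₙ⁽ᵐ⁾(0)` are `1`. -/
def upsilon (p : ℕ) [Fact p.Prime] (s : ℂ) (m : ℕ∞) (x : ℚ_[p]) : ℂ :=
  (1 - s ^ x.valuation) / (1 - s) +
    ∑' j : ℕ, s ^ (x.valuation + (j : ℤ)) * chi p m (x.valuation + (j : ℤ)) x

/-- `Δₛ⁽ᵐ⁾ = inf { |Υ(x) - Υ(y)| : |x - y|ₚ = 1 }`. -/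
def separation (p : ℕ) [Fact p.Prime] (s : ℂ) (m : ℕ∞) : ℝ :=
  sInf {r : ℝ | ∃ x y : ℚ_[p], ‖x - y‖ = 1 ∧ r = ‖upsilon p s m x - upsilon p s m y‖}

/-- The scaling dimension `Dₛ = -1 / log_p |s|`. -/
def scalingDim (p : ℕ) (s : ℂ) : ℝ := -(Real.logb p ‖s‖)⁻¹

/-- `ℤₚ` as a subset of `ℚₚ`. -/
def unitBall (p : ℕ) [Fact p.Prime] : Set ℚ_[p] := {x | ‖x‖ ≤ 1}

/-- The `Dₛ`-dimensional Hausdorff measure of `B ∩ Υ(ℚₚ)`, normalized by that of `Υ(ℤₚ)`;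
defined for all `B ⊆ ℂ`. -/
def fractalMeasure (p : ℕ) [Fact p.Prime] (s : ℂ) (m : ℕ∞) (B : Set ℂ) : ENNReal :=
  Measure.hausdorffMeasure (scalingDim p s) (B ∩ Set.range (upsilon p s m)) /
    Measure.hausdorffMeasure (scalingDim p s) (upsilon p s m '' unitBall p)

instance padicMeasurableSpace (p : ℕ) [Fact p.Prime] : MeasurableSpace ℚ_[p] := borel _

instance padicBorelSpace (p : ℕ) [Fact p.Prime] : BorelSpace ℚ_[p] := ⟨rfl⟩

/-- `ℤₚ` is compact with nonempty interior. -/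
def unitBallCompacts (p : ℕ) [Fact p.Prime] : TopologicalSpace.PositiveCompacts ℚ_[p] where
  carrier := unitBall p
  isCompact' := by
    have h : unitBall p = Metric.closedBall (0 : ℚ_[p]) 1 := by
      ext x; simp [unitBall]
    rw [h]
    exact isCompact_closedBall _ _
  interior_nonempty' := by
    have h : unitBall p = Metric.closedBall (0 : ℚ_[p]) 1 := by
      ext x; simp [unitBall]
    rw [h]
    exact ⟨0, Metric.ball_subset_interior_closedBall (by simp)⟩

/-- The standard Haar measure on `ℚₚ`, with value `1` on `ℤₚ`. -/
def haar (p : ℕ) [Fact p.Prime] : Measure ℚ_[p] := Measure.addHaarMeasure (unitBallCompacts p)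

end

end PadicFractal

/-!
Write `D = Dₛ`. Since `χₙ(x) = 1` for `n < v(x)`, the head of `Υ` is a regularized geometric sum, and
`Υ(x) = 1 / (1 - s) + ∑_{n ∈ ℤ} sⁿ (χₙ(x) - 1)` (`upsilon_eq`). Multiplication by `p` shifts the
digits, so `Υ(pᵏx) - Υ(pᵏy) = sᵏ (Υ(x) - Υ(y))`. By this scaling, `Δ > 0` bounds `|Υ(x) - Υ(y)|` below
by `Δ |x - y|^{1/D}`, while the series bounds it above by a constant times `|x - y|^{1/D}`. Hence `Υ`
is a measurable embedding, and `ν(A) = h^D(Υ(A))` is a Borel measure on `ℚ_[p]` (`pullback`)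
comparable to one-dimensional Hausdorff measure; in particular `0 < ν(ℤ_p) < ∞`.

It remains to see that `ν` is a multiple of Haar measure, and as balls form a π-system it is enough
to compare the two on balls. By scaling, `ν(pᵏA) = p⁻ᵏ ν(A)`, so the question is whether
`F(a) = ν(a + ℤ_p)` depends on `a`. For `m > 0` the pieces `Υ(a + ℤ_p)` need not be similar to each
other, so `F` is not constant for trivial reasons. Two facts make it constant:

* splitting `a + ℤ_p` into `p` balls and rescaling them shows that `F(a)` is the average of `F` over
  the `p` points obtained by appending a digit to `a` (`pullback_real_mean`);
* if `a` and `b` have the same digits at the places `-M, …, -1`, then exchanging the digits at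
  negative places is a Lipschitz map from `Υ(a + ℤ_p)` to `Υ(b + ℤ_p)` with constant `1 + O(p^{-M})`
  (`norm_upsilon_splice_sub_le`), so that `F(b) ≤ (1 + O(p^{-M}))^D F(a)`.

If `F(a)` is nearly `sup F`, then by the first fact so is `F` at every `M`-th generation descendant of
`a`. Any given `b` shares its last `M` digits with one of those, so the second fact forces `F(b)` to be
nearly `sup F` as well (`harmonic_eq`).

The identity of measures extends to arbitrary sets, since the comap of a measure along a measurable
embedding is given by the measure of the image for all sets.
-/

namespace PadicFractal

/-! ### Digits and the `p`-adic metric -/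

section Digits

variable {p : ℕ} [hp : Fact p.Prime]

theorem digit_lt (x : ℚ_[p]) (n : ℤ) : digit p x n < p :=
  (isExpansion_digit p x).1 n

theorem IsExpansion.digit_eq {x : ℚ_[p]} {a : ℤ → ℕ} (h : IsExpansion p x a) : digit p x = a :=
  (isExpansion_digit p x).unique h

theorem digit_zero (n : ℤ) : digit p 0 n = 0 := by
  have h : IsExpansion p 0 (fun _ => 0) :=
    ⟨fun _ => hp.out.pos, ⟨0, fun _ _ => rfl⟩, by simp⟩
  rw [h.digit_eq]

theorem digit_zpow_mul (k : ℤ) (x : ℚ_[p]) (n : ℤ) :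
    digit p ((p : ℚ_[p]) ^ k * x) n = digit p x (n - k) := by
  have hp0 : (p : ℚ_[p]) ≠ 0 := mod_cast hp.out.ne_zero
  obtain ⟨h1, ⟨v, hv⟩, h3⟩ := isExpansion_digit p x
  have h : IsExpansion p ((p : ℚ_[p]) ^ k * x) (fun n => digit p x (n - k)) := by
    refine ⟨fun n => h1 _, ⟨v + k, fun n hn => hv _ (by omega)⟩, ?_⟩
    rw [← (Equiv.addRight k).hasSum_iff]
    refine (h3.mul_left ((p : ℚ_[p]) ^ k)).congr_fun fun n => ?_
    simp only [Function.comp_apply, Equiv.coe_addRight, add_sub_cancel_right, zpow_add₀ hp0]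
    ring
  rw [h.digit_eq]

/-- The point obtained from `x` by replacing its `n`-th digit by `d`. -/
noncomputable def setDigit (x : ℚ_[p]) (n : ℤ) (d : ℕ) : ℚ_[p] :=
  x + ((d : ℚ_[p]) - digit p x n) * (p : ℚ_[p]) ^ n

theorem digit_setDigit (x : ℚ_[p]) (n : ℤ) {d : ℕ} (hd : d < p) :
    digit p (setDigit x n d) = Function.update (digit p x) n d := by
  obtain ⟨h1, ⟨v, hv⟩, h3⟩ := isExpansion_digit p x
  refine IsExpansion.digit_eq ⟨fun k => ?_, ⟨min v n, fun k hk => ?_⟩, ?_⟩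
  · rcases eq_or_ne k n with rfl | h
    · simpa using hd
    · simpa [h] using h1 k
  · rw [lt_min_iff] at hk
    rw [Function.update_of_ne hk.2.ne, hv k hk.1]
  · have hx : setDigit x n d =
        (d : ℚ_[p]) * (p : ℚ_[p]) ^ n - digit p x n * (p : ℚ_[p]) ^ n + x := by
      rw [setDigit]
      ring
    rw [hx]
    refine (h3.update n ((d : ℚ_[p]) * (p : ℚ_[p]) ^ n)).congr_fun fun k => ?_
    rcases eq_or_ne k n with rfl | h <;> simp [*]

/-- The point whose digits at negative places are those of `b` and whose digits at the places
`n ≥ 0` are those of `x`. -/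
noncomputable def splice (b x : ℚ_[p]) : ℚ_[p] :=
  ∑' n : ℤ, ((if n < 0 then digit p b n else digit p x n : ℕ) : ℚ_[p]) * (p : ℚ_[p]) ^ n

theorem digit_splice (b x : ℚ_[p]) :
    digit p (splice b x) = fun n => if n < 0 then digit p b n else digit p x n := by
  obtain ⟨h1, ⟨v, hv⟩, h3⟩ := isExpansion_digit p b
  obtain ⟨k1, -, k3⟩ := isExpansion_digit p x
  refine IsExpansion.digit_eq ⟨fun n => ?_, ⟨min v 0, fun n hn => ?_⟩, Summable.hasSum ?_⟩
  · dsimp only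
    split_ifs
    exacts [h1 n, k1 n]
  · rw [lt_min_iff] at hn
    exact (if_pos hn.2).trans (hv n hn.1)
  · refine ((h3.summable.indicator {n | n < 0}).add
      (k3.summable.indicator {n | n < 0}ᶜ)).congr fun n => ?_
    by_cases hn : n < 0
    · simp [hn]
    · simp [hn]

theorem norm_sub_le_of_digit_eq {x y : ℚ_[p]} {N : ℤ}
    (h : ∀ n < N, digit p x n = digit p y n) : ‖x - y‖ ≤ (p : ℝ) ^ (-N) := by
  have hp1 : (1 : ℝ) < p := mod_cast hp.out.one_lt
  have hd := (isExpansion_digit p x).2.2.sub (isExpansion_digit p y).2.2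
  refine (Metric.isClosed_closedBall (x := (0 : ℚ_[p])) (ε := (p : ℝ) ^ (-N))).mem_of_tendsto
      hd (Filter.Eventually.of_forall fun t => ?_) |> mem_closedBall_zero_iff.1
  rw [mem_closedBall_zero_iff]
  refine IsUltrametricDist.norm_sum_le_of_forall_le_of_nonneg (by positivity) fun k _ => ?_
  rcases lt_or_ge k N with hk | hk
  · rw [h k hk, sub_self, norm_zero]
    positivity
  · rw [← sub_mul, norm_mul, Padic.norm_p_zpow]
    have h1 : ‖((digit p x k : ℚ_[p]) - digit p y k)‖ ≤ 1 := by
      have := Padic.norm_int_le_one (p := p) ((digit p x k : ℤ) - digit p y k)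
      push_cast at this
      exact this
    calc _ ≤ 1 * (p : ℝ) ^ (-k) := by gcongr
      _ ≤ _ := by
        rw [one_mul]
        exact zpow_le_zpow_right₀ hp1.le (by omega)

theorem norm_sub_setDigit (x : ℚ_[p]) (n : ℤ) {d : ℕ} (hd : d < p) (hne : digit p x n ≠ d) :
    ‖x - setDigit x n d‖ = (p : ℝ) ^ (-n) := by
  have h0 : x - setDigit x n d =
      (((digit p x n : ℤ) - (d : ℤ) : ℤ) : ℚ_[p]) * (p : ℚ_[p]) ^ n := by
    rw [setDigit]
    push_cast
    ring
  rw [h0, norm_mul, Padic.norm_p_zpow]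
  have h1 : ‖(((digit p x n : ℤ) - (d : ℤ) : ℤ) : ℚ_[p])‖ = 1 := by
    refine le_antisymm (Padic.norm_int_le_one _) (not_lt.1 fun h => ?_)
    rw [Padic.norm_intCast_lt_one_iff] at h
    have h2 := Int.eq_zero_of_abs_lt_dvd h (by
      have := digit_lt x n
      rw [abs_lt]
      omega)
    exact hne (by omega)
  rw [h1, one_mul]

/-- The closed ball of radius `p ^ (-N)` about `x` consists of the points whose digits agree with
those of `x` at all places below `N`. -/
theorem norm_sub_le_iff {x y : ℚ_[p]} {N : ℤ} :
    ‖x - y‖ ≤ (p : ℝ) ^ (-N) ↔ ∀ n < N, digit p x n = digit p y n := by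
  refine ⟨fun h => ?_, norm_sub_le_of_digit_eq⟩
  have hp1 : (1 : ℝ) < p := mod_cast hp.out.one_lt
  by_contra! hne
  obtain ⟨v, hv⟩ := (isExpansion_digit p x).2.1
  obtain ⟨w, hw⟩ := (isExpansion_digit p y).2.1
  obtain ⟨n, ⟨hnN, hn⟩, hmin⟩ := Int.exists_least_of_bdd
    (P := fun n => n < N ∧ digit p x n ≠ digit p y n)
    ⟨min v w, fun z hz => by
      by_contra h
      rw [not_le, lt_min_iff] at h
      exact hz.2 (by rw [hv z h.1, hw z h.2])⟩ hne
  -- correct the first wrong digit of `x`: this moves `x` by exactly `p ^ (-n)`, and the result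
  -- is closer than that to `y`
  have h1 := norm_sub_setDigit x n (digit_lt y n) hn
  have h2 : ‖setDigit x n (digit p y n) - y‖ ≤ (p : ℝ) ^ (-(n + 1)) := by
    refine norm_sub_le_of_digit_eq fun k hk => ?_
    rw [digit_setDigit x n (digit_lt y n)]
    rcases eq_or_ne k n with rfl | hkn
    · simp
    · rw [Function.update_of_ne hkn]
      by_contra h'
      have := hmin k ⟨by omega, h'⟩
      omega
  have h3 : ‖x - setDigit x n (digit p y n)‖ ≤
      max ‖x - y‖ ‖setDigit x n (digit p y n) - y‖ := by
    rw [← sub_add_sub_cancel x y, norm_sub_rev (setDigit x n _) y]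
    exact Padic.nonarchimedean (x - y) (y - setDigit x n _)
  rw [h1] at h3
  rcases le_max_iff.1 h3 with h4 | h4
  · have := zpow_lt_zpow_right₀ hp1 (show -N < -n by omega)
    linarith
  · have := zpow_lt_zpow_right₀ hp1 (show -(n + 1) < -n by omega)
    linarith

theorem mem_closedBall_iff_digit {x y : ℚ_[p]} {N : ℤ} :
    y ∈ Metric.closedBall x ((p : ℝ) ^ (-N)) ↔ ∀ n < N, digit p y n = digit p x n := by
  rw [mem_closedBall_iff_norm, norm_sub_le_iff]

theorem mem_closedBall_one_iff_digit {x y : ℚ_[p]} :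
    y ∈ Metric.closedBall x 1 ↔ ∀ n < 0, digit p y n = digit p x n := by
  rw [← mem_closedBall_iff_digit, neg_zero, zpow_zero]

theorem digit_eq_zero_of_lt_valuation (x : ℚ_[p]) {n : ℤ} (hn : n < x.valuation) :
    digit p x n = 0 := by
  have h : ‖x - 0‖ ≤ (p : ℝ) ^ (-x.valuation) := by
    rw [sub_zero]
    rcases eq_or_ne x 0 with rfl | hx
    · simp
    · exact (Padic.norm_eq_zpow_neg_valuation hx).le
  rw [norm_sub_le_iff.1 h n hn, digit_zero]

theorem exists_norm_sub_eq_zpow {x y : ℚ_[p]} (h : x ≠ y) : ∃ N : ℤ, ‖x - y‖ = (p : ℝ) ^ (-N) :=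
  ⟨_, Padic.norm_eq_zpow_neg_valuation (sub_ne_zero.2 h)⟩

/-- The splicing map carries any ball of radius `1` onto the ball of radius `1` about `b`. -/
theorem splice_image_closedBall (a b : ℚ_[p]) :
    splice b '' Metric.closedBall a 1 = Metric.closedBall b 1 := by
  ext y
  rw [mem_closedBall_one_iff_digit]
  constructor
  · rintro ⟨x, -, rfl⟩ n hn
    simp [digit_splice, hn]
  · intro hy
    refine ⟨splice a y, mem_closedBall_one_iff_digit.2 fun n hn => by simp [digit_splice, hn], ?_⟩
    have h : IsExpansion p (splice b (splice a y)) (digit p y) := by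
      have := isExpansion_digit p (splice b (splice a y))
      rwa [show digit p (splice b (splice a y)) = digit p y by
        ext n
        by_cases hn : n < 0 <;> simp [digit_splice, hn, hy]] at this
    exact h.2.2.unique (isExpansion_digit p y).2.2

end Digits

/-! ### The characters `χₙ` -/

section Characters

variable {p : ℕ} [hp : Fact p.Prime] {m : ℕ∞}

/-- The real number `∑_{k=0}^m x_{n-k} p^{-k}` for which `χₙ(x) = exp (2πi / p * phase)`. -/
noncomputable def phase (p : ℕ) [Fact p.Prime] (m : ℕ∞) (n : ℤ) (x : ℚ_[p]) : ℝ :=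
  ∑' k : ℕ, if (k : ℕ∞) ≤ m then (digit p x (n - k) : ℝ) / (p : ℝ) ^ k else 0

theorem chi_eq_exp_phase (n : ℤ) (x : ℚ_[p]) :
    chi p m n x = Complex.exp (Complex.I * ((2 * Real.pi / p * phase p m n x : ℝ) : ℂ)) := by
  rw [chi, phase]
  congr 1
  push_cast
  have h : ∀ k : ℕ, (((if (k : ℕ∞) ≤ m then (digit p x (n - k) : ℝ) / (p : ℝ) ^ k else 0 : ℝ)) : ℂ)
      = if (k : ℕ∞) ≤ m then (digit p x (n - k) : ℂ) / (p : ℂ) ^ k else 0 := by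
    intro k
    split_ifs <;> simp
  simp_rw [h]
  ring

theorem norm_chi (n : ℤ) (x : ℚ_[p]) : ‖chi p m n x‖ = 1 := by
  rw [chi_eq_exp_phase, mul_comm, Complex.norm_exp_ofReal_mul_I]

theorem chi_congr {n : ℤ} {x y : ℚ_[p]} (h : ∀ k ≤ n, digit p x k = digit p y k) :
    chi p m n x = chi p m n y := by
  rw [chi, chi]
  congr 3
  ext k
  rw [h (n - k) (by omega)]

theorem chi_eq_one {n : ℤ} {x : ℚ_[p]} (h : ∀ k ≤ n, digit p x k = 0) : chi p m n x = 1 := by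
  rw [chi]
  have : ∀ k : ℕ, digit p x (n - k) = 0 := fun k => h _ (by omega)
  simp [this]

theorem chi_zpow_mul (k n : ℤ) (x : ℚ_[p]) :
    chi p m n ((p : ℚ_[p]) ^ k * x) = chi p m (n - k) x := by
  rw [chi, chi]
  congr 3
  ext j
  rw [digit_zpow_mul, sub_right_comm]

theorem summable_const_mul_inv_pow (p : ℕ) [hp : Fact p.Prime] :
    Summable fun k : ℕ => (p : ℝ) * ((p : ℝ)⁻¹) ^ k :=
  (summable_geometric_of_lt_one (by positivity)
    (inv_lt_one_of_one_lt₀ (mod_cast hp.out.one_lt))).mul_left _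

theorem summable_phase (n : ℤ) (x : ℚ_[p]) :
    Summable fun k : ℕ => if (k : ℕ∞) ≤ m then (digit p x (n - k) : ℝ) / (p : ℝ) ^ k else 0 := by
  refine Summable.of_norm_bounded (summable_const_mul_inv_pow p) fun k => ?_
  have h1 : (digit p x (n - k) : ℝ) ≤ p := mod_cast (digit_lt x _).le
  split_ifs
  · rw [Real.norm_of_nonneg (by positivity), inv_pow, div_eq_mul_inv]
    gcongr
  · rw [norm_zero]
    positivity

/-- The bound on the change of `χₙ`, `n ≥ 0`, when the digits at the places below `-M` are
altered. -/
noncomputable def tailBound (p M : ℕ) : ℝ :=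
  2 * Real.pi / p * ((p : ℝ) * ((p : ℝ)⁻¹) ^ M * (1 - (p : ℝ)⁻¹)⁻¹)

theorem tailBound_nonneg (p M : ℕ) [hp : Fact p.Prime] : 0 ≤ tailBound p M := by
  have h : (p : ℝ)⁻¹ < 1 := inv_lt_one_of_one_lt₀ (mod_cast hp.out.one_lt)
  have h' : 0 ≤ 1 - (p : ℝ)⁻¹ := by linarith
  have := Real.pi_pos
  unfold tailBound
  positivity

theorem tendsto_tailBound (p : ℕ) [hp : Fact p.Prime] :
    Filter.Tendsto (tailBound p) Filter.atTop (nhds 0) := by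
  have h := tendsto_pow_atTop_nhds_zero_of_lt_one (r := (p : ℝ)⁻¹) (by positivity)
    (inv_lt_one_of_one_lt₀ (mod_cast hp.out.one_lt))
  have h2 := ((h.const_mul (p : ℝ)).mul_const (1 - (p : ℝ)⁻¹)⁻¹).const_mul (2 * Real.pi / p)
  rw [mul_zero, zero_mul, mul_zero] at h2
  exact h2

/-- On a ball of radius `1`, splicing multiplies `χₙ` by a unit complex number that depends on `n`
only, as no carries occur when digit strings with disjoint supports are added. It is close to `1`
if the digits before the splice agree at many places. -/
theorem exists_chi_splice {a b : ℚ_[p]} {M : ℕ}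
    (hab : ∀ n : ℤ, -M ≤ n → n < 0 → digit p a n = digit p b n) {n : ℤ} (hn : 0 ≤ n) :
    ∃ θ : ℂ, ‖θ - 1‖ ≤ tailBound p M ∧
      ∀ x ∈ Metric.closedBall a 1, chi p m n (splice b x) = θ * chi p m n x := by
  set u : ℕ → ℝ := fun k => if (k : ℕ∞) ≤ m ∧ n - k < 0 then
    ((digit p b (n - k) : ℝ) - digit p a (n - k)) / (p : ℝ) ^ k else 0 with hu
  have hpinv : (p : ℝ)⁻¹ < 1 := inv_lt_one_of_one_lt₀ (mod_cast hp.out.one_lt)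
  have hu1 : ∀ k, ‖u k‖ ≤ (p : ℝ) * ((p : ℝ)⁻¹) ^ k := by
    intro k
    simp only [hu]
    have h1 : (digit p a (n - k) : ℝ) ≤ p := mod_cast (digit_lt a _).le
    have h2 : (digit p b (n - k) : ℝ) ≤ p := mod_cast (digit_lt b _).le
    have h3 : (0 : ℝ) ≤ digit p a (n - k) := by positivity
    have h4 : (0 : ℝ) ≤ digit p b (n - k) := by positivity
    split_ifs
    · rw [inv_pow, div_eq_mul_inv, norm_mul, Real.norm_of_nonneg (r := (_ : ℝ)⁻¹) (by positivity)]
      gcongr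
      rw [Real.norm_eq_abs, abs_le]
      constructor <;> linarith
    · rw [norm_zero]
      positivity
  have hu0 : ∀ k < M, u k = 0 := by
    intro k hk
    simp only [hu]
    split_ifs with h
    · rw [hab (n - k) (by omega) h.2, sub_self, zero_div]
    · rfl
  have husum : Summable u := Summable.of_norm_bounded (summable_const_mul_inv_pow p) hu1
  have hbound : ‖∑' k, u k‖ ≤ (p : ℝ) * ((p : ℝ)⁻¹) ^ M * (1 - (p : ℝ)⁻¹)⁻¹ := by
    rw [← husum.sum_add_tsum_nat_add M, Finset.sum_eq_zero fun k hk => hu0 k (Finset.mem_range.1 hk),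
      zero_add]
    refine tsum_of_norm_bounded
      ((hasSum_geometric_of_lt_one (by positivity) hpinv).mul_left _) fun k => (hu1 _).trans_eq ?_
    rw [pow_add]
    ring
  refine ⟨Complex.exp (Complex.I * ((2 * Real.pi / p * ∑' k, u k : ℝ) : ℂ)), ?_, fun x hx => ?_⟩
  · refine Real.norm_exp_I_mul_ofReal_sub_one_le.trans ?_
    rw [norm_mul, Real.norm_of_nonneg (r := 2 * Real.pi / p) (by positivity), tailBound]
    gcongr
  · rw [chi_eq_exp_phase, chi_eq_exp_phase, ← Complex.exp_add, ← mul_add, ← Complex.ofReal_add,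
      ← mul_add]
    congr 5
    rw [phase, phase, ← husum.tsum_add (summable_phase n x)]
    congr 1
    ext k
    rw [mem_closedBall_one_iff_digit] at hx
    simp only [hu, digit_splice]
    by_cases h1 : (k : ℕ∞) ≤ m <;> by_cases h2 : n - k < 0
    · simp only [h1, h2, hx _ h2, and_self, if_true]
      ring
    all_goals simp [h1, h2]

end Characters

/-! ### The map `Υ` -/

section Upsilon

variable {p : ℕ} [hp : Fact p.Prime] {s : ℂ} {m : ℕ∞}

theorem zpow_mul_series_bound (hs0 : s ≠ 0) (hs1 : ‖s‖ < 1) {g : ℤ → ℂ} {N : ℤ} {c : ℝ}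
    (hg : ∀ n, ‖g n‖ ≤ c) (hg0 : ∀ n < N, g n = 0) :
    Summable (fun n : ℤ => s ^ n * g n) ∧
      ‖∑' n : ℤ, s ^ n * g n‖ ≤ c * (1 - ‖s‖)⁻¹ * ‖s‖ ^ N := by
  have hinj : Function.Injective (fun j : ℕ => N + (j : ℤ)) := by
    intro i j h
    simpa using h
  have hsupp : ∀ n ∉ Set.range (fun j : ℕ => N + (j : ℤ)), s ^ n * g n = 0 := by
    intro n hn
    rw [hg0 n, mul_zero]
    by_contra h
    exact hn ⟨(n - N).toNat, by dsimp only; omega⟩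
  have hb : ∀ j : ℕ, ‖s ^ (N + (j : ℤ)) * g (N + j)‖ ≤ c * ‖s‖ ^ N * ‖s‖ ^ j := by
    intro j
    rw [norm_mul, zpow_add₀ hs0, zpow_natCast, norm_mul, norm_zpow, norm_pow]
    calc _ ≤ ‖s‖ ^ N * ‖s‖ ^ j * c := by
          gcongr
          exact hg _
      _ = _ := by ring
  have hgeo := (hasSum_geometric_of_lt_one (norm_nonneg s) hs1).mul_left (c * ‖s‖ ^ N)
  have hsum : Summable fun j : ℕ => s ^ (N + (j : ℤ)) * g (N + j) :=
    Summable.of_norm_bounded hgeo.summable hb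
  refine ⟨(hinj.summable_iff hsupp).1 hsum, ?_⟩
  rw [← hinj.tsum_eq (f := fun n : ℤ => s ^ n * g n)
    fun n hn => by
      by_contra h
      exact hn (hsupp n h)]
  exact (tsum_of_norm_bounded hgeo hb).trans_eq (by ring)

theorem norm_chi_sub_le (n : ℤ) (x y : ℚ_[p]) : ‖chi p m n x - chi p m n y‖ ≤ 2 :=
  (norm_sub_le _ _).trans_eq (by rw [norm_chi, norm_chi]; norm_num)

theorem summable_chi_sub_one (hs0 : s ≠ 0) (hs1 : ‖s‖ < 1) (x : ℚ_[p]) :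
    Summable fun n : ℤ => s ^ n * (chi p m n x - 1) := by
  refine (zpow_mul_series_bound hs0 hs1 (N := x.valuation) (c := 2) (fun n => ?_)
    fun n hn => ?_).1
  · refine (norm_sub_le _ _).trans_eq ?_
    rw [norm_chi, norm_one]
    norm_num
  · rw [chi_eq_one fun k hk => digit_eq_zero_of_lt_valuation x (by omega), sub_self]

/-- The head `(1 - s ^ v) / (1 - s)` of `Υ` is the regularized sum of `sⁿ` over `n < v`, where
`χₙ = 1`. So `Υ` is a constant plus a sum over all of `ℤ` that does not involve `v`. -/
theorem upsilon_eq (hs0 : s ≠ 0) (hs1 : ‖s‖ < 1) (x : ℚ_[p]) :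
    upsilon p s m x = (1 - s)⁻¹ + ∑' n : ℤ, s ^ n * (chi p m n x - 1) := by
  have hinj : Function.Injective (fun j : ℕ => x.valuation + (j : ℤ)) := by
    intro i j h
    simpa using h
  have hs : 1 - s ≠ 0 := by
    rw [sub_ne_zero]
    rintro rfl
    simp at hs1
  rw [← hinj.tsum_eq (f := fun n : ℤ => s ^ n * (chi p m n x - 1)) fun n hn => by
    by_contra h
    refine hn ?_
    dsimp only
    rw [chi_eq_one fun k hk => digit_eq_zero_of_lt_valuation x ?_, sub_self, mul_zero]
    by_contra h'
    exact h ⟨(n - x.valuation).toNat, by dsimp only; omega⟩]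
  have h1 : Summable fun j : ℕ =>
      s ^ (x.valuation + (j : ℤ)) * (chi p m (x.valuation + (j : ℤ)) x - 1) :=
    (summable_chi_sub_one hs0 hs1 x).comp_injective hinj
  have h2 : HasSum (fun j : ℕ => s ^ (x.valuation + (j : ℤ))) (s ^ x.valuation * (1 - s)⁻¹) := by
    refine ((hasSum_geometric_of_norm_lt_one hs1).mul_left _).congr_fun fun j => ?_
    rw [zpow_add₀ hs0, zpow_natCast]
  have h3 := h1.hasSum.add h2
  simp only [mul_sub, mul_one, sub_add_cancel] at h3
  rw [upsilon, h3.tsum_eq]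
  simp only [mul_sub, mul_one]
  field_simp
  ring

theorem upsilon_sub (hs0 : s ≠ 0) (hs1 : ‖s‖ < 1) (x y : ℚ_[p]) :
    upsilon p s m x - upsilon p s m y =
      ∑' n : ℤ, s ^ n * (chi p m n x - chi p m n y) := by
  rw [upsilon_eq hs0 hs1, upsilon_eq hs0 hs1, add_sub_add_left_eq_sub,
    ← (summable_chi_sub_one hs0 hs1 x).tsum_sub (summable_chi_sub_one hs0 hs1 y)]
  congr 1
  ext n
  ring

theorem upsilon_zpow_mul_sub (hs0 : s ≠ 0) (hs1 : ‖s‖ < 1) (k : ℤ) (x y : ℚ_[p]) :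
    upsilon p s m ((p : ℚ_[p]) ^ k * x) - upsilon p s m ((p : ℚ_[p]) ^ k * y) =
      s ^ k * (upsilon p s m x - upsilon p s m y) := by
  rw [upsilon_sub hs0 hs1, upsilon_sub hs0 hs1, ← (Equiv.addRight k).tsum_eq, ← tsum_mul_left]
  congr 1
  ext n
  rw [Equiv.coe_addRight, chi_zpow_mul, chi_zpow_mul, add_sub_cancel_right, zpow_add₀ hs0]
  ring

theorem norm_upsilon_sub_le (hs0 : s ≠ 0) (hs1 : ‖s‖ < 1) {x y : ℚ_[p]} {N : ℤ}
    (h : ‖x - y‖ ≤ (p : ℝ) ^ (-N)) :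
    ‖upsilon p s m x - upsilon p s m y‖ ≤ 2 * (1 - ‖s‖)⁻¹ * ‖s‖ ^ N := by
  rw [upsilon_sub hs0 hs1]
  refine (zpow_mul_series_bound hs0 hs1 (fun n => norm_chi_sub_le n x y) fun n hn => ?_).2
  rw [chi_congr fun k hk => norm_sub_le_iff.1 h k (by omega), sub_self]

theorem separation_mul_le (hs0 : s ≠ 0) (hs1 : ‖s‖ < 1) {x y : ℚ_[p]} {N : ℤ}
    (h : ‖x - y‖ = (p : ℝ) ^ (-N)) :
    separation p s m * ‖s‖ ^ N ≤ ‖upsilon p s m x - upsilon p s m y‖ := by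
  have hp0 : (p : ℚ_[p]) ≠ 0 := mod_cast hp.out.ne_zero
  have hpR : (p : ℝ) ≠ 0 := mod_cast hp.out.ne_zero
  have h1 := upsilon_zpow_mul_sub (m := m) hs0 hs1 N ((p : ℚ_[p]) ^ (-N) * x)
    ((p : ℚ_[p]) ^ (-N) * y)
  rw [← mul_assoc, ← mul_assoc, ← zpow_add₀ hp0, add_neg_cancel, zpow_zero, one_mul, one_mul] at h1
  rw [h1, norm_mul, norm_zpow, mul_comm]
  gcongr
  refine csInf_le ⟨0, ?_⟩ ⟨_, _, ?_, rfl⟩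
  · rintro r ⟨x, y, -, rfl⟩
    positivity
  · rw [← mul_sub, norm_mul, Padic.norm_p_zpow, h, ← zpow_add₀ hpR]
    simp

/-- Splicing digits at negative places that agree back to place `-M` is almost an isometry for
the metric pulled back along `Υ`. -/
theorem norm_upsilon_splice_sub_le (hs0 : s ≠ 0) (hs1 : ‖s‖ < 1) (hΔ : 0 < separation p s m)
    {a b : ℚ_[p]} {M : ℕ} (hab : ∀ n : ℤ, -M ≤ n → n < 0 → digit p a n = digit p b n)
    {x y : ℚ_[p]} (hx : x ∈ Metric.closedBall a 1) (hy : y ∈ Metric.closedBall a 1) :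
    ‖upsilon p s m (splice b x) - upsilon p s m (splice b y)‖ ≤
      (1 + tailBound p M * (2 * (1 - ‖s‖)⁻¹ / separation p s m)) *
        ‖upsilon p s m x - upsilon p s m y‖ := by
  rcases eq_or_ne x y with rfl | hxy
  · simp
  have hs1' : 0 < 1 - ‖s‖ := by linarith
  obtain ⟨N, hN⟩ := exists_norm_sub_eq_zpow hxy
  have hbelow := norm_sub_le_iff.1 hN.le
  have hsplice : ∀ k : ℤ, (∀ j ≤ k, digit p x j = digit p y j) →
      chi p m k (splice b x) = chi p m k (splice b y) := by
    intro k hk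
    refine chi_congr fun j hj => ?_
    simp only [digit_splice, hk j hj]
  have hneg : ∀ n < 0, chi p m n x = chi p m n y ∧
      chi p m n (splice b x) = chi p m n (splice b y) := by
    intro n hn
    rw [mem_closedBall_one_iff_digit] at hx hy
    have : ∀ j ≤ n, digit p x j = digit p y j := fun j hj => by
      rw [hx j (by omega), hy j (by omega)]
    exact ⟨chi_congr this, hsplice n this⟩
  set d : ℤ → ℂ := fun n => chi p m n (splice b x) - chi p m n (splice b y) -
    (chi p m n x - chi p m n y) with hd
  have hd0 : ∀ n < N, d n = 0 := by
    intro n hn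
    have : ∀ j ≤ n, digit p x j = digit p y j := fun j hj => hbelow j (by omega)
    simp only [hd, chi_congr this, hsplice n this, sub_self]
  have hdb : ∀ n, ‖d n‖ ≤ tailBound p M * 2 := by
    intro n
    have ht := tailBound_nonneg p M
    rcases lt_or_ge n 0 with hn | hn
    · simp only [hd, hneg n hn, sub_self, norm_zero]
      positivity
    · obtain ⟨θ, hθ, hθ'⟩ := exists_chi_splice (m := m) hab hn
      have : d n = (θ - 1) * (chi p m n x - chi p m n y) := by
        simp only [hd, hθ' x hx, hθ' y hy]
        ring
      rw [this, norm_mul]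
      gcongr
      exact norm_chi_sub_le n x y
  have hdiff : upsilon p s m (splice b x) - upsilon p s m (splice b y) =
      (upsilon p s m x - upsilon p s m y) + ∑' n : ℤ, s ^ n * d n := by
    have hsum : ∀ u v : ℚ_[p], Summable fun n : ℤ => s ^ n * (chi p m n u - chi p m n v) := by
      intro u v
      refine ((summable_chi_sub_one (m := m) hs0 hs1 u).sub
        (summable_chi_sub_one (m := m) hs0 hs1 v)).congr fun n => ?_
      ring
    rw [upsilon_sub hs0 hs1, upsilon_sub hs0 hs1,
      ← (hsum x y).tsum_add (zpow_mul_series_bound hs0 hs1 hdb hd0).1]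
    congr 1
    ext n
    simp only [hd]
    ring
  have h1 := (zpow_mul_series_bound hs0 hs1 hdb hd0).2
  have h2 := separation_mul_le (m := m) hs0 hs1 hN
  have h3 : ‖s‖ ^ N ≤ ‖upsilon p s m x - upsilon p s m y‖ / separation p s m := by
    rw [le_div_iff₀ hΔ, mul_comm]
    exact h2
  rw [hdiff, add_mul, one_mul]
  refine (norm_add_le _ _).trans (add_le_add_right (h1.trans ?_) _)
  calc tailBound p M * 2 * (1 - ‖s‖)⁻¹ * ‖s‖ ^ N
      ≤ tailBound p M * 2 * (1 - ‖s‖)⁻¹ *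
        (‖upsilon p s m x - upsilon p s m y‖ / separation p s m) := by
        have ht := tailBound_nonneg p M
        gcongr
    _ = _ := by ring

end Upsilon

/-! ### Haar measure and one-dimensional Hausdorff measure on `ℚ_[p]` -/

section Measures

open scoped ENNReal NNReal

variable {p : ℕ} [hp : Fact p.Prime]

theorem measure_closedBall_eq_sum (μ : Measure ℚ_[p]) (x : ℚ_[p]) (N : ℤ) :
    μ (Metric.closedBall x ((p : ℝ) ^ (-N))) =
      ∑ d ∈ Finset.range p, μ (Metric.closedBall (setDigit x N d) ((p : ℝ) ^ (-(N + 1)))) := by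
  rw [← measure_biUnion_finset _ fun d _ => Metric.isClosed_closedBall.measurableSet]
  · congr 1
    ext y
    simp only [Set.mem_iUnion, mem_closedBall_iff_digit, Finset.mem_range, exists_prop]
    constructor
    · intro h
      refine ⟨digit p y N, digit_lt y N, fun n hn => ?_⟩
      rw [digit_setDigit x N (digit_lt y N)]
      rcases eq_or_ne n N with rfl | hne
      · simp
      · rw [Function.update_of_ne hne, h n (by omega)]
    · rintro ⟨d, hd, h⟩ n hn
      rw [h n (by omega), digit_setDigit x N hd, Function.update_of_ne hn.ne]
  · intro d hd e he hde
    rw [Function.onFun, Set.disjoint_left]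
    intro y hy hy'
    rw [Finset.mem_coe, Finset.mem_range] at hd he
    rw [mem_closedBall_iff_digit] at hy hy'
    have h1 := hy N (by omega)
    have h2 := hy' N (by omega)
    rw [digit_setDigit x N hd, Function.update_self] at h1
    rw [digit_setDigit x N he, Function.update_self] at h2
    exact hde (h1.symm.trans h2)

instance isAddHaarMeasure_haar : (haar p).IsAddHaarMeasure :=
  inferInstanceAs (Measure.addHaarMeasure (unitBallCompacts p)).IsAddHaarMeasure

theorem unitBall_eq_closedBall : unitBall p = Metric.closedBall 0 1 := by
  ext x
  simp [unitBall]

theorem haar_closedBall_center (x : ℚ_[p]) (r : ℝ) :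
    haar p (Metric.closedBall x r) = haar p (Metric.closedBall 0 r) := by
  rw [← measure_preimage_add (haar p) (-x) (Metric.closedBall 0 r)]
  congr 1
  ext y
  simp [dist_eq_norm, sub_eq_neg_add]

theorem haar_closedBall (x : ℚ_[p]) (N : ℤ) :
    haar p (Metric.closedBall x ((p : ℝ) ^ (-N))) = ENNReal.ofReal ((p : ℝ) ^ (-N)) := by
  have hp0 : (p : ℝ) ≠ 0 := mod_cast hp.out.ne_zero
  have hpE : (p : ℝ≥0∞) ≠ 0 := mod_cast hp.out.ne_zero
  rw [haar_closedBall_center]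
  have hstep : ∀ N : ℤ, haar p (Metric.closedBall 0 ((p : ℝ) ^ (-N))) =
      p * haar p (Metric.closedBall 0 ((p : ℝ) ^ (-(N + 1)))) := by
    intro N
    rw [measure_closedBall_eq_sum]
    simp_rw [haar_closedBall_center (setDigit _ _ _)]
    simp
  have hstep' : ∀ N : ℤ, ENNReal.ofReal ((p : ℝ) ^ (-N)) =
      p * ENNReal.ofReal ((p : ℝ) ^ (-(N + 1))) := by
    intro N
    rw [← ENNReal.ofReal_natCast p, ← ENNReal.ofReal_mul (by positivity)]
    congr 1
    rw [neg_add, zpow_add₀ hp0, zpow_neg_one]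
    field_simp
  induction N using Int.induction_on with
  | zero =>
    rw [neg_zero, zpow_zero, ENNReal.ofReal_one, ← unitBall_eq_closedBall]
    exact Measure.addHaarMeasure_self (K₀ := unitBallCompacts p)
  | succ n ih =>
    rw [hstep, hstep'] at ih
    exact (ENNReal.mul_right_inj hpE (by simp)).1 ih
  | pred n ih =>
    rw [hstep, hstep', sub_add_cancel, ih]

theorem haar_le_hausdorffMeasure : haar p ≤ Measure.hausdorffMeasure 1 := by
  refine Measure.le_hausdorffMeasure 1 (haar p) 1 one_pos fun t ht => ?_
  have hp1 : (1 : ℝ) < p := mod_cast hp.out.one_lt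
  rw [ENNReal.rpow_one]
  rcases t.eq_empty_or_nonempty with rfl | ⟨x, hx⟩
  · simp
  rcases eq_or_ne (Metric.ediam t) 0 with h0 | h0
  · have : t.Subsingleton := Metric.ediam_eq_zero_iff.1 h0
    rw [this.measure_zero]
    exact zero_le
  have htop : Metric.ediam t ≠ ⊤ := (ht.trans_lt ENNReal.one_lt_top).ne
  obtain ⟨n, hn1, hn2⟩ := exists_mem_Ico_zpow (ENNReal.toReal_pos h0 htop) hp1
  have hsub : t ⊆ Metric.closedBall x ((p : ℝ) ^ (-(-n))) := by
    intro y hy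
    rw [mem_closedBall_iff_norm, neg_neg, Padic.norm_le_pow_iff_norm_lt_pow_add_one]
    refine lt_of_le_of_lt ?_ hn2
    rw [← dist_eq_norm, ← ENNReal.ofReal_le_iff_le_toReal htop, ← edist_dist]
    exact Metric.edist_le_ediam_of_mem hy hx
  refine (measure_mono hsub).trans ?_
  rw [haar_closedBall, neg_neg]
  exact (ENNReal.ofReal_le_iff_le_toReal htop).2 hn1

theorem ediam_closedBall_le (x : ℚ_[p]) (N : ℤ) :
    Metric.ediam (Metric.closedBall x ((p : ℝ) ^ (-N))) ≤ ENNReal.ofReal ((p : ℝ) ^ (-N)) := by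
  refine Metric.ediam_le fun y hy z hz => ?_
  rw [mem_closedBall_iff_digit] at hy hz
  rw [edist_dist, dist_eq_norm]
  refine ENNReal.ofReal_le_ofReal (norm_sub_le_of_digit_eq fun n hn => ?_)
  rw [hy n hn, hz n hn]

theorem exists_nat_mem_closedBall {a x : ℚ_[p]} (hx : x ∈ Metric.closedBall a 1) (N : ℕ) :
    ∃ i : Fin (p ^ N), x ∈ Metric.closedBall (a + ((i : ℕ) : ℚ_[p])) ((p : ℝ) ^ (-(N : ℤ))) := by
  rw [mem_closedBall_iff_norm] at hx
  set z : ℤ_[p] := ⟨x - a, hx⟩ with hz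
  refine ⟨⟨z.appr N, z.appr_lt N⟩, ?_⟩
  have h := (PadicInt.norm_le_pow_iff_mem_span_pow _ N).2 (z.appr_spec N)
  rw [PadicInt.norm_def] at h
  push_cast at h
  rw [mem_closedBall_iff_norm, ← sub_sub]
  exact h

theorem hausdorffMeasure_closedBall_le (a : ℚ_[p]) :
    Measure.hausdorffMeasure 1 (Metric.closedBall a 1) ≤ 1 := by
  have hp0 : (p : ℝ) ≠ 0 := mod_cast hp.out.ne_zero
  have hr : Filter.Tendsto (fun N : ℕ => ENNReal.ofReal ((p : ℝ) ^ (-(N : ℤ)))) Filter.atTop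
      (nhds 0) := by
    have h := tendsto_pow_atTop_nhds_zero_of_lt_one (r := (p : ℝ)⁻¹) (by positivity)
      (inv_lt_one_of_one_lt₀ (mod_cast hp.out.one_lt))
    have h2 := ENNReal.tendsto_ofReal h
    simpa using h2
  refine (Measure.hausdorffMeasure_le_liminf_sum (ι := fun N : ℕ => Fin (p ^ N)) 1 _ _ hr
    (fun N i => Metric.closedBall (a + ((i : ℕ) : ℚ_[p])) ((p : ℝ) ^ (-(N : ℤ))))
    (Filter.Eventually.of_forall fun N i => ediam_closedBall_le _ _)
    (Filter.Eventually.of_forall fun N x hx =>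
      Set.mem_iUnion.2 (exists_nat_mem_closedBall hx N))).trans ?_
  refine Filter.liminf_le_of_le (by isBoundedDefault) fun c hc => ?_
  obtain ⟨N, hN⟩ := hc.exists
  refine hN.trans ?_
  calc _ ≤ ∑ _i : Fin (p ^ N), ENNReal.ofReal ((p : ℝ) ^ (-(N : ℤ))) := by
        refine Finset.sum_le_sum fun i _ => ?_
        rw [ENNReal.rpow_one]
        exact ediam_closedBall_le _ _
    _ = 1 := by
        rw [Finset.sum_const, Finset.card_univ, Fintype.card_fin, nsmul_eq_mul,
          ← ENNReal.ofReal_natCast, ← ENNReal.ofReal_mul (by positivity), Nat.cast_pow, zpow_neg,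
          zpow_natCast, mul_inv_cancel₀ (pow_ne_zero _ hp0), ENNReal.ofReal_one]

/-- Two measures on `ℚ_[p]` that agree on all balls are equal, as any two balls are nested or
disjoint. -/
theorem measure_ext_closedBall {μ ν : Measure ℚ_[p]}
    (h : ∀ (x : ℚ_[p]) (N : ℤ), μ (Metric.closedBall x ((p : ℝ) ^ (-N))) =
      ν (Metric.closedBall x ((p : ℝ) ^ (-N))))
    (hfin : ∀ N : ℤ, μ (Metric.closedBall 0 ((p : ℝ) ^ (-N))) ≠ ⊤) : μ = ν := by
  have hp1 : (1 : ℝ) < p := mod_cast hp.out.one_lt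
  set C : Set (Set ℚ_[p]) :=
    Set.range fun q : ℚ_[p] × ℤ => Metric.closedBall q.1 ((p : ℝ) ^ (-q.2)) with hC
  have hopen : ∀ t ∈ C, IsOpen t := by
    rintro _ ⟨q, rfl⟩
    exact IsUltrametricDist.isOpen_closedBall _ (by positivity)
  have hbasis : TopologicalSpace.IsTopologicalBasis C := by
    refine TopologicalSpace.isTopologicalBasis_of_isOpen_of_nhds hopen fun x U hx hU => ?_
    obtain ⟨ε, hε, hsub⟩ := Metric.isOpen_iff.1 hU x hx
    obtain ⟨N, hN⟩ := exists_pow_lt_of_lt_one hε (inv_lt_one_of_one_lt₀ hp1)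
    refine ⟨_, ⟨(x, (N : ℤ)), rfl⟩, Metric.mem_closedBall_self (by positivity), ?_⟩
    refine (Metric.closedBall_subset_ball ?_).trans hsub
    simpa using hN
  refine Measure.ext_of_generateFrom_of_iUnion C
    (fun N : ℕ => Metric.closedBall 0 ((p : ℝ) ^ (-(-(N : ℤ))))) ?_ ?_ ?_ ?_ (fun N => hfin _) ?_
  · rw [← hbasis.borel_eq_generateFrom]
    rfl
  · rintro _ ⟨⟨x, N⟩, rfl⟩ _ ⟨⟨y, K⟩, rfl⟩ ⟨z, hz1, hz2⟩
    refine ⟨(z, max N K), ?_⟩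
    ext w
    dsimp only at hz1 hz2 ⊢
    rw [mem_closedBall_iff_digit] at hz1 hz2
    rw [Set.mem_inter_iff, mem_closedBall_iff_digit, mem_closedBall_iff_digit,
      mem_closedBall_iff_digit]
    constructor
    · exact fun hw => ⟨fun n hn => by rw [hw n (by omega), hz1 n hn],
        fun n hn => by rw [hw n (by omega), hz2 n hn]⟩
    · rintro ⟨h1, h2⟩ n hn
      rcases lt_max_iff.1 hn with h' | h'
      · rw [h1 n h', hz1 n h']
      · rw [h2 n h', hz2 n h']
  · rw [Set.iUnion_eq_univ_iff]
    intro x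
    obtain ⟨K, hK⟩ := pow_unbounded_of_one_lt ‖x‖ hp1
    refine ⟨K, ?_⟩
    rw [mem_closedBall_zero_iff, neg_neg, zpow_natCast]
    exact hK.le
  · exact fun N => ⟨(0, -(N : ℤ)), rfl⟩
  · rintro _ ⟨q, rfl⟩
    exact h q.1 q.2

/-- Comparison of the Hausdorff measures of two images of the same set, when the distances in one
image are bounded by a power of the distances in the other. -/
theorem hausdorffMeasure_image_le_image {X Y Z : Type*} [MetricSpace Y] [MeasurableSpace Y]
    [BorelSpace Y] [MetricSpace Z] [MeasurableSpace Z] [BorelSpace Z] {f : X → Y} {g : X → Z}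
    {A : Set X} {C r : ℝ} (hC : 0 ≤ C) (hr : 0 < r) {d : ℝ} (hd : 0 ≤ d)
    (h : ∀ x ∈ A, ∀ y ∈ A, dist (f x) (f y) ≤ C * dist (g x) (g y) ^ r) :
    Measure.hausdorffMeasure d (f '' A) ≤
      ENNReal.ofReal C ^ d * Measure.hausdorffMeasure (r * d) (g '' A) := by
  rcases A.eq_empty_or_nonempty with rfl | ⟨a, ha⟩
  · simp
  have : Nonempty X := ⟨a⟩
  set φ : Z → Y := f ∘ Function.invFunOn g A with hφ
  have hinv : ∀ x ∈ A, Function.invFunOn g A (g x) ∈ A ∧ g (Function.invFunOn g A (g x)) = g x :=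
    fun x hx => Function.invFunOn_pos ⟨x, hx, rfl⟩
  have himg : f '' A = φ '' (g '' A) := by
    rw [Set.image_image]
    refine Set.image_congr fun x hx => ?_
    have h1 := h x hx _ (hinv x hx).1
    rw [(hinv x hx).2, dist_self, Real.zero_rpow hr.ne', mul_zero] at h1
    exact dist_le_zero.1 h1
  have hH : HolderOnWith C.toNNReal r.toNNReal φ (g '' A) := by
    rintro _ ⟨x, hx, rfl⟩ _ ⟨y, hy, rfl⟩
    have h1 := h _ (hinv x hx).1 _ (hinv y hy).1
    rw [(hinv x hx).2, (hinv y hy).2] at h1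
    rw [edist_dist, edist_dist, Real.coe_toNNReal r hr.le,
      ENNReal.ofReal_rpow_of_nonneg dist_nonneg hr.le]
    exact (ENNReal.ofReal_le_ofReal h1).trans_eq (ENNReal.ofReal_mul hC)
  rw [himg]
  have := hH.hausdorffMeasure_image_le (Real.toNNReal_pos.2 hr) hd
  rwa [Real.coe_toNNReal r hr.le] at this

end Measures

/-! ### Harmonic functions on the tree of digits -/

section Harmonic

variable {p : ℕ} [hp : Fact p.Prime]

/-- The centre, rescaled to radius `1`, of the `d`-th of the `p` balls that make up the ball of
radius `1` about `a`. -/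
noncomputable def child (a : ℚ_[p]) (d : ℕ) : ℚ_[p] :=
  (p : ℚ_[p]) ^ (-1 : ℤ) * setDigit a 0 d

theorem digit_child (a : ℚ_[p]) {d : ℕ} (hd : d < p) (n : ℤ) :
    digit p (child a d) n = if n = -1 then d else digit p a (n + 1) := by
  rw [child, digit_zpow_mul, digit_setDigit a 0 hd, sub_neg_eq_add, Function.update_apply]
  congr 1
  rw [eq_neg_iff_add_eq_zero]

/-- If the mean value property holds and `F a` is within `ε` of an upper bound `S`, then `F` is
within `p ^ M * ε` of `S` at all `M`-th generation descendants of `a`. These descendants realize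
every string of digits at the places from `-M` to `-1`. -/
theorem exists_descendant {F : ℚ_[p] → ℝ} {S : ℝ} (hS : ∀ a, F a ≤ S)
    (hF : ∀ a, p * F a = ∑ d ∈ Finset.range p, F (child a d)) (M : ℕ) (b a : ℚ_[p]) :
    ∃ a' : ℚ_[p], (∀ n : ℤ, -M ≤ n → n < 0 → digit p a' n = digit p b n) ∧
      S - F a' ≤ p ^ M * (S - F a) := by
  induction M generalizing b with
  | zero => exact ⟨a, fun n h1 h2 => by push_cast at h1; omega, by simp⟩
  | succ M ih =>
    obtain ⟨a', h1, h2⟩ := ih ((p : ℚ_[p]) ^ (1 : ℤ) * b)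
    refine ⟨child a' (digit p b (-1)), fun n hn1 hn2 => ?_, ?_⟩
    · rw [digit_child a' (digit_lt b _)]
      split_ifs with h
      · rw [h]
      · rw [h1 (n + 1) (by push_cast at hn1; omega) (by omega), digit_zpow_mul,
          add_sub_cancel_right]
    · have hsum : ∑ d ∈ Finset.range p, (S - F (child a' d)) = p * (S - F a') := by
        rw [Finset.sum_sub_distrib, ← hF, Finset.sum_const, Finset.card_range, nsmul_eq_mul,
          mul_sub]
      calc S - F (child a' (digit p b (-1))) ≤ ∑ d ∈ Finset.range p, (S - F (child a' d)) :=
            Finset.single_le_sum (f := fun d => S - F (child a' d))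
              (fun d _ => sub_nonneg.2 (hS _)) (Finset.mem_range.2 (digit_lt b _))
        _ = p * (S - F a') := hsum
        _ ≤ p * (p ^ M * (S - F a)) := by gcongr
        _ = _ := by ring

/-- A form of the maximum principle: a bounded function with the mean value property is constant
if its values at `a` and `b` are close whenever `a` and `b` share many digits just below
the place `0`. -/
theorem harmonic_eq {F : ℚ_[p] → ℝ} {S₀ : ℝ} (hS₀ : ∀ a, F a ≤ S₀)
    (hF : ∀ a, p * F a = ∑ d ∈ Finset.range p, F (child a d)) {K : ℕ → ℝ}
    (hK : Filter.Tendsto K Filter.atTop (nhds 1))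
    (hclose : ∀ (M : ℕ) (a b : ℚ_[p]),
      (∀ n : ℤ, -M ≤ n → n < 0 → digit p a n = digit p b n) → F a ≤ K M * F b)
    (a b : ℚ_[p]) : F a = F b := by
  have hbdd : BddAbove (Set.range F) := ⟨S₀, by rintro _ ⟨a, rfl⟩; exact hS₀ a⟩
  have hS : ∀ a, F a ≤ ⨆ x, F x := le_ciSup hbdd
  have key : ∀ b, (⨆ x, F x) ≤ F b := by
    intro b
    have hM : ∀ M : ℕ, (⨆ x, F x) ≤ K M * F b := by
      intro M
      refine le_of_forall_pos_le_add fun ε hε => ?_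
      have hpM : (0 : ℝ) < p ^ M := pow_pos (mod_cast hp.out.pos) M
      obtain ⟨a, ha⟩ := exists_lt_of_lt_ciSup
        (show (⨆ x, F x) - ε / p ^ M < ⨆ x, F x from sub_lt_self _ (by positivity))
      obtain ⟨a', h1, h2⟩ := exists_descendant hS hF M b a
      have h3 := hclose M a' b h1
      have h4 : (p : ℝ) ^ M * ((⨆ x, F x) - F a) ≤ ε := by
        rw [← le_div_iff₀' hpM]
        linarith
      linarith
    have hlim := hK.mul_const (F b)
    rw [one_mul] at hlim
    exact ge_of_tendsto' hlim hM
  exact le_antisymm ((hS a).trans (key b)) ((hS b).trans (key a))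

end Harmonic

/-! ### The Hausdorff measure pulled back along `Υ` -/

section Pullback

open scoped ENNReal

variable {p : ℕ} [hp : Fact p.Prime] {s : ℂ} {m : ℕ∞}

theorem scalingDim_pos (hs0 : s ≠ 0) (hs1 : ‖s‖ < 1) : 0 < scalingDim p s := by
  have := Real.logb_neg (b := p) (mod_cast hp.out.one_lt) (norm_pos_iff.2 hs0) hs1
  rw [scalingDim, neg_pos]
  exact inv_lt_zero.2 this

theorem norm_zpow_rpow_scalingDim (hs0 : s ≠ 0) (hs1 : ‖s‖ < 1) (N : ℤ) :
    (‖s‖ ^ N) ^ scalingDim p s = (p : ℝ) ^ (-N) := by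
  have hp0 : (0 : ℝ) < p := mod_cast hp.out.pos
  have hp1 : (1 : ℝ) < p := mod_cast hp.out.one_lt
  have hlog := Real.logb_neg (b := p) hp1 (norm_pos_iff.2 hs0) hs1
  conv_lhs => rw [← Real.rpow_logb hp0 hp1.ne' (norm_pos_iff.2 hs0)]
  rw [← Real.rpow_intCast, ← Real.rpow_intCast, ← Real.rpow_mul hp0.le, ← Real.rpow_mul hp0.le]
  congr 1
  rw [scalingDim]
  push_cast
  field_simp [hlog.ne]

theorem rpow_inv_scalingDim (hs0 : s ≠ 0) (hs1 : ‖s‖ < 1) (N : ℤ) :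
    ((p : ℝ) ^ (-N)) ^ (scalingDim p s)⁻¹ = ‖s‖ ^ N := by
  rw [← norm_zpow_rpow_scalingDim hs0 hs1, ← Real.rpow_mul (by positivity),
    mul_inv_cancel₀ (scalingDim_pos hs0 hs1).ne', Real.rpow_one]

theorem dist_upsilon_le (hs0 : s ≠ 0) (hs1 : ‖s‖ < 1) (x y : ℚ_[p]) :
    dist (upsilon p s m x) (upsilon p s m y) ≤
      2 * (1 - ‖s‖)⁻¹ * dist x y ^ (scalingDim p s)⁻¹ := by
  rcases eq_or_ne x y with rfl | hxy
  · rw [dist_self, dist_self, Real.zero_rpow (inv_pos.2 (scalingDim_pos hs0 hs1)).ne', mul_zero]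
  obtain ⟨N, hN⟩ := exists_norm_sub_eq_zpow hxy
  rw [dist_eq_norm, dist_eq_norm, hN, rpow_inv_scalingDim hs0 hs1]
  exact norm_upsilon_sub_le hs0 hs1 hN.le

theorem dist_le_dist_upsilon (hs0 : s ≠ 0) (hs1 : ‖s‖ < 1) (hΔ : 0 < separation p s m)
    (x y : ℚ_[p]) : dist x y ≤ (separation p s m)⁻¹ ^ scalingDim p s *
      dist (upsilon p s m x) (upsilon p s m y) ^ scalingDim p s := by
  rcases eq_or_ne x y with rfl | hxy
  · rw [dist_self]
    positivity
  obtain ⟨N, hN⟩ := exists_norm_sub_eq_zpow hxy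
  rw [dist_eq_norm, dist_eq_norm, hN, ← norm_zpow_rpow_scalingDim hs0 hs1,
    ← Real.mul_rpow (by positivity) (by positivity)]
  refine Real.rpow_le_rpow (by positivity) ?_ (scalingDim_pos hs0 hs1).le
  rw [inv_mul_eq_div, le_div_iff₀ hΔ, mul_comm]
  exact separation_mul_le hs0 hs1 hN

theorem measurableEmbedding_upsilon (hs0 : s ≠ 0) (hs1 : ‖s‖ < 1) (hΔ : 0 < separation p s m) :
    MeasurableEmbedding (upsilon p s m) := by
  have hD := scalingDim_pos (p := p) hs0 hs1
  refine Continuous.measurableEmbedding ?_ fun x y hxy => ?_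
  · refine continuous_iff_continuousAt.2 fun x => tendsto_iff_dist_tendsto_zero.2 ?_
    refine squeeze_zero (fun _ => dist_nonneg) (fun y => dist_upsilon_le hs0 hs1 y x) ?_
    have h1 : Continuous fun y : ℚ_[p] =>
        2 * (1 - ‖s‖)⁻¹ * dist y x ^ (scalingDim p s)⁻¹ :=
      continuous_const.mul ((continuous_id.dist continuous_const).rpow_const
        fun _ => Or.inr (inv_pos.2 hD).le)
    have h2 := h1.tendsto x
    rwa [dist_self, Real.zero_rpow (inv_pos.2 hD).ne', mul_zero] at h2
  · have h := dist_le_dist_upsilon hs0 hs1 hΔ x y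
    rw [hxy, dist_self, Real.zero_rpow hD.ne', mul_zero] at h
    exact dist_le_zero.1 h

/-- The measure `A ↦ h^{Dₛ}(Υ(A))` on `ℚ_[p]`. -/
noncomputable def pullback (p : ℕ) [Fact p.Prime] (s : ℂ) (m : ℕ∞) : Measure ℚ_[p] :=
  (Measure.hausdorffMeasure (scalingDim p s)).comap (upsilon p s m)

theorem pullback_apply (hs0 : s ≠ 0) (hs1 : ‖s‖ < 1) (hΔ : 0 < separation p s m)
    (A : Set ℚ_[p]) : pullback p s m A =
      Measure.hausdorffMeasure (scalingDim p s) (upsilon p s m '' A) :=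
  (measurableEmbedding_upsilon hs0 hs1 hΔ).comap_apply _ _

theorem pullback_closedBall_one_le (hs0 : s ≠ 0) (hs1 : ‖s‖ < 1) (hΔ : 0 < separation p s m)
    (a : ℚ_[p]) : pullback p s m (Metric.closedBall a 1) ≤
      ENNReal.ofReal (2 * (1 - ‖s‖)⁻¹) ^ scalingDim p s := by
  have hD := scalingDim_pos (p := p) hs0 hs1
  have hs1' : 0 < 1 - ‖s‖ := by linarith
  have h := hausdorffMeasure_image_le_image (f := upsilon p s m) (g := id)
    (A := Metric.closedBall a 1) (C := 2 * (1 - ‖s‖)⁻¹) (by positivity) (inv_pos.2 hD) hD.le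
    fun x _ y _ => dist_upsilon_le hs0 hs1 x y
  rw [inv_mul_cancel₀ hD.ne', Set.image_id] at h
  rw [pullback_apply hs0 hs1 hΔ]
  exact h.trans (mul_le_of_le_one_right' (hausdorffMeasure_closedBall_le a))

theorem pullback_closedBall_one_ne_top (hs0 : s ≠ 0) (hs1 : ‖s‖ < 1)
    (hΔ : 0 < separation p s m) (a : ℚ_[p]) : pullback p s m (Metric.closedBall a 1) ≠ ⊤ :=
  ((pullback_closedBall_one_le hs0 hs1 hΔ a).trans_lt
    (ENNReal.rpow_lt_top_of_nonneg (scalingDim_pos hs0 hs1).le ENNReal.ofReal_ne_top)).ne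

theorem pullback_closedBall_one_ne_zero (hs0 : s ≠ 0) (hs1 : ‖s‖ < 1)
    (hΔ : 0 < separation p s m) : pullback p s m (Metric.closedBall 0 1) ≠ 0 := by
  have hD := scalingDim_pos (p := p) hs0 hs1
  have h := hausdorffMeasure_image_le_image (f := id) (g := upsilon p s m)
    (A := Metric.closedBall 0 1) (C := (separation p s m)⁻¹ ^ scalingDim p s) (by positivity) hD
    zero_le_one fun x _ y _ => dist_le_dist_upsilon hs0 hs1 hΔ x y
  rw [Set.image_id, mul_one, ← pullback_apply hs0 hs1 hΔ] at h
  intro h0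
  rw [h0, mul_zero] at h
  have h1 := (haar_le_hausdorffMeasure (p := p) _).trans h
  have h2 := haar_closedBall (0 : ℚ_[p]) 0
  rw [neg_zero, zpow_zero, ENNReal.ofReal_one] at h2
  rw [h2] at h1
  exact absurd h1 (by simp)

theorem pullback_image_zpow_mul_le (hs0 : s ≠ 0) (hs1 : ‖s‖ < 1) (hΔ : 0 < separation p s m)
    (k : ℤ) (A : Set ℚ_[p]) : pullback p s m ((fun x => (p : ℚ_[p]) ^ k * x) '' A) ≤
      ENNReal.ofReal ((p : ℝ) ^ (-k)) * pullback p s m A := by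
  have hD := scalingDim_pos (p := p) hs0 hs1
  have h := hausdorffMeasure_image_le_image
    (f := fun x => upsilon p s m ((p : ℚ_[p]) ^ k * x)) (g := upsilon p s m)
    (A := A) (C := ‖s‖ ^ k) (by positivity) one_pos hD.le fun x _ y _ => by
      rw [Real.rpow_one, dist_eq_norm, dist_eq_norm, upsilon_zpow_mul_sub hs0 hs1, norm_mul,
        norm_zpow]
  rw [ENNReal.ofReal_rpow_of_nonneg (by positivity) hD.le, norm_zpow_rpow_scalingDim hs0 hs1,
    one_mul] at h
  rwa [pullback_apply hs0 hs1 hΔ, pullback_apply hs0 hs1 hΔ, Set.image_image]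

theorem pullback_image_zpow_mul (hs0 : s ≠ 0) (hs1 : ‖s‖ < 1) (hΔ : 0 < separation p s m)
    (k : ℤ) (A : Set ℚ_[p]) : pullback p s m ((fun x => (p : ℚ_[p]) ^ k * x) '' A) =
      ENNReal.ofReal ((p : ℝ) ^ (-k)) * pullback p s m A := by
  have hp0 : (p : ℚ_[p]) ≠ 0 := mod_cast hp.out.ne_zero
  have hpR : (p : ℝ) ≠ 0 := mod_cast hp.out.ne_zero
  refine le_antisymm (pullback_image_zpow_mul_le hs0 hs1 hΔ k A) ?_
  have h := pullback_image_zpow_mul_le hs0 hs1 hΔ (-k) ((fun x => (p : ℚ_[p]) ^ k * x) '' A)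
  have h1 : ∀ x : ℚ_[p], (p : ℚ_[p]) ^ (-k) * ((p : ℚ_[p]) ^ k * x) = x := fun x => by
    rw [← mul_assoc, ← zpow_add₀ hp0, neg_add_cancel, zpow_zero, one_mul]
  rw [Set.image_image] at h
  simp only [h1, Set.image_id'] at h
  calc _ ≤ ENNReal.ofReal ((p : ℝ) ^ (-k)) * (ENNReal.ofReal ((p : ℝ) ^ (-(-k))) *
        pullback p s m ((fun x => (p : ℚ_[p]) ^ k * x) '' A)) := by gcongr
    _ = _ := by
      rw [← mul_assoc, ← ENNReal.ofReal_mul (by positivity), ← zpow_add₀ hpR, add_neg_cancel,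
        zpow_zero, ENNReal.ofReal_one, one_mul]

theorem image_zpow_mul_closedBall (x : ℚ_[p]) (N : ℤ) :
    (fun y => (p : ℚ_[p]) ^ N * y) '' Metric.closedBall ((p : ℚ_[p]) ^ (-N) * x) 1 =
      Metric.closedBall x ((p : ℝ) ^ (-N)) := by
  have hp0 : (p : ℚ_[p]) ≠ 0 := mod_cast hp.out.ne_zero
  have h1 : ∀ k : ℤ, ∀ x : ℚ_[p], (p : ℚ_[p]) ^ k * ((p : ℚ_[p]) ^ (-k) * x) = x := fun k x => by
    rw [← mul_assoc, ← zpow_add₀ hp0, add_neg_cancel, zpow_zero, one_mul]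
  ext y
  rw [mem_closedBall_iff_digit]
  constructor
  · rintro ⟨z, hz, rfl⟩ n hn
    rw [mem_closedBall_one_iff_digit] at hz
    have := hz (n - N) (by omega)
    rw [digit_zpow_mul] at this ⊢
    rw [this]
    congr 1
    omega
  · intro hy
    refine ⟨(p : ℚ_[p]) ^ (-N) * y, mem_closedBall_one_iff_digit.2 fun n hn => ?_, h1 N y⟩
    rw [digit_zpow_mul, digit_zpow_mul, hy _ (by omega)]

theorem pullback_closedBall (hs0 : s ≠ 0) (hs1 : ‖s‖ < 1) (hΔ : 0 < separation p s m)
    (x : ℚ_[p]) (N : ℤ) : pullback p s m (Metric.closedBall x ((p : ℝ) ^ (-N))) =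
      ENNReal.ofReal ((p : ℝ) ^ (-N)) *
        pullback p s m (Metric.closedBall ((p : ℚ_[p]) ^ (-N) * x) 1) := by
  rw [← image_zpow_mul_closedBall, pullback_image_zpow_mul hs0 hs1 hΔ]

/-- The mean value property of `a ↦ h^{Dₛ}(Υ(a + ℤ_p))`. -/
theorem pullback_real_mean (hs0 : s ≠ 0) (hs1 : ‖s‖ < 1) (hΔ : 0 < separation p s m)
    (a : ℚ_[p]) : p * (pullback p s m).real (Metric.closedBall a 1) =
      ∑ d ∈ Finset.range p, (pullback p s m).real (Metric.closedBall (child a d) 1) := by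
  have hp0 : (p : ℝ) ≠ 0 := mod_cast hp.out.ne_zero
  have h := measure_closedBall_eq_sum (pullback p s m) a 0
  rw [neg_zero, zpow_zero, zero_add] at h
  simp only [pullback_closedBall hs0 hs1 hΔ, ← Finset.mul_sum] at h
  rw [Measure.real, h, ENNReal.toReal_mul, ENNReal.toReal_ofReal (by positivity),
    ENNReal.toReal_sum fun d _ => pullback_closedBall_one_ne_top hs0 hs1 hΔ _, zpow_neg_one,
    mul_inv_cancel_left₀ hp0]
  rfl

theorem pullback_closedBall_one_le_of_digit_eq (hs0 : s ≠ 0) (hs1 : ‖s‖ < 1)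
    (hΔ : 0 < separation p s m) {M : ℕ} {a b : ℚ_[p]}
    (hab : ∀ n : ℤ, -M ≤ n → n < 0 → digit p a n = digit p b n) :
    (pullback p s m).real (Metric.closedBall a 1) ≤
      (1 + tailBound p M * (2 * (1 - ‖s‖)⁻¹ / separation p s m)) ^ scalingDim p s *
        (pullback p s m).real (Metric.closedBall b 1) := by
  have hD := scalingDim_pos (p := p) hs0 hs1
  have ht := tailBound_nonneg p M
  have hs1' : 0 < 1 - ‖s‖ := by linarith
  set K : ℝ := 1 + tailBound p M * (2 * (1 - ‖s‖)⁻¹ / separation p s m) with hK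
  have hK0 : 0 ≤ K := by positivity
  have h := hausdorffMeasure_image_le_image
    (f := fun x => upsilon p s m (splice a x)) (g := upsilon p s m)
    (A := Metric.closedBall b 1) hK0 one_pos hD.le fun x hx y hy => by
      rw [Real.rpow_one, dist_eq_norm, dist_eq_norm]
      exact norm_upsilon_splice_sub_le hs0 hs1 hΔ (fun n h1 h2 => (hab n h1 h2).symm) hx hy
  rw [← Set.image_image, splice_image_closedBall, one_mul, ← pullback_apply hs0 hs1 hΔ,
    ← pullback_apply hs0 hs1 hΔ, ENNReal.ofReal_rpow_of_nonneg hK0 hD.le] at h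
  have h1 := ENNReal.toReal_mono
    (ENNReal.mul_ne_top ENNReal.ofReal_ne_top (pullback_closedBall_one_ne_top hs0 hs1 hΔ b)) h
  rwa [ENNReal.toReal_mul, ENNReal.toReal_ofReal (by positivity)] at h1

theorem pullback_closedBall_one_eq (hs0 : s ≠ 0) (hs1 : ‖s‖ < 1) (hΔ : 0 < separation p s m)
    (a b : ℚ_[p]) :
    pullback p s m (Metric.closedBall a 1) = pullback p s m (Metric.closedBall b 1) := by
  have hD := scalingDim_pos (p := p) hs0 hs1
  have hlim : Filter.Tendsto (fun M : ℕ =>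
      (1 + tailBound p M * (2 * (1 - ‖s‖)⁻¹ / separation p s m)) ^ scalingDim p s)
      Filter.atTop (nhds 1) := by
    have h := (((tendsto_tailBound p).mul_const
      (2 * (1 - ‖s‖)⁻¹ / separation p s m)).const_add 1).rpow_const
        (p := scalingDim p s) (Or.inr hD.le)
    rwa [zero_mul, add_zero, Real.one_rpow] at h
  refine (ENNReal.toReal_eq_toReal_iff' (pullback_closedBall_one_ne_top hs0 hs1 hΔ a)
    (pullback_closedBall_one_ne_top hs0 hs1 hΔ b)).1 ?_
  exact harmonic_eq (F := fun a => (pullback p s m).real (Metric.closedBall a 1))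
    (fun a => ENNReal.toReal_mono
      (ENNReal.rpow_lt_top_of_nonneg hD.le ENNReal.ofReal_ne_top).ne
      (pullback_closedBall_one_le hs0 hs1 hΔ a))
    (pullback_real_mean hs0 hs1 hΔ) hlim
    (fun M a b => pullback_closedBall_one_le_of_digit_eq hs0 hs1 hΔ) a b

theorem pullback_eq_smul_haar (hs0 : s ≠ 0) (hs1 : ‖s‖ < 1) (hΔ : 0 < separation p s m) :
    pullback p s m = pullback p s m (Metric.closedBall 0 1) • haar p := by
  refine measure_ext_closedBall (fun x N => ?_) fun N => ?_
  · rw [Measure.smul_apply, smul_eq_mul, haar_closedBall, pullback_closedBall hs0 hs1 hΔ,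
      pullback_closedBall_one_eq hs0 hs1 hΔ _ 0, mul_comm]
  · rw [pullback_closedBall hs0 hs1 hΔ]
    exact ENNReal.mul_ne_top ENNReal.ofReal_ne_top (pullback_closedBall_one_ne_top hs0 hs1 hΔ _)

end Pullback

end PadicFractal

theorem theorem7 (p : ℕ) [Fact p.Prime] (s : ℂ) (hs0 : s ≠ 0) (hs1 : ‖s‖ < 1) (m : ℕ∞)
    (hΔ : 0 < PadicFractal.separation p s m) :
    (Measure.hausdorffMeasure (PadicFractal.scalingDim p s)
        (PadicFractal.upsilon p s m '' PadicFractal.unitBall p) ≠ 0 ∧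
      Measure.hausdorffMeasure (PadicFractal.scalingDim p s)
        (PadicFractal.upsilon p s m '' PadicFractal.unitBall p) ≠ ⊤) ∧
    ∀ B : Set ℂ, PadicFractal.fractalMeasure p s m B =
      PadicFractal.haar p (PadicFractal.upsilon p s m ⁻¹' B) := by
  have h0 := PadicFractal.pullback_closedBall_one_ne_zero hs0 hs1 hΔ
  have htop := PadicFractal.pullback_closedBall_one_ne_top hs0 hs1 hΔ 0
  rw [PadicFractal.unitBall_eq_closedBall, ← PadicFractal.pullback_apply hs0 hs1 hΔ]
  refine ⟨⟨h0, htop⟩, fun B => ?_⟩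
  rw [PadicFractal.fractalMeasure, PadicFractal.unitBall_eq_closedBall,
    ← Set.image_preimage_eq_inter_range, ← PadicFractal.pullback_apply hs0 hs1 hΔ,
    ← PadicFractal.pullback_apply hs0 hs1 hΔ]
  conv_lhs => rw [PadicFractal.pullback_eq_smul_haar hs0 hs1 hΔ]
  have h1 : PadicFractal.haar p (Metric.closedBall 0 1) = 1 := by
    simpa using PadicFractal.haar_closedBall (0 : ℚ_[p]) 0
  simp only [Measure.smul_apply, smul_eq_mul, h1, mul_one]
  rw [mul_comm, ENNReal.mul_div_cancel_right h0 htop]
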